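/- Let $R$ be a commutative ring with identity that is $2$-torsion free ($2r=0$ implies $r=0$), and let $(X,\le)$ be a locally finite preordered set ($\le$ is reflexive and transitive, and $\{z : x\le z\le y\}$ is finite for all $x\le y$) that is connected, i.e. any two elements of $X$ are joined by a finite sequence in which consecutive elements are comparable. Let $I(X,R)$ be the incidence algebra: the $R$-module of all functions $f:X\times X\to R$ with $f(x,y)=0$ whenever $x\not\le y$, with product $(fg)(x,y)=\sum_{x\le z\le y}f(x,z)g(z,y)$. Let $L:I(X,R)\to I(X,R)$ be a Lie derivation, i.e. an $R$-linear map with $L([f,g])=[L(f),g]+[f,L(g)]$ for all $f,g$, where $[f,g]=fg-gf$. Then $L=D+F$, where $D:I(X,R)\to I(X,R)$ is a derivation, i.e. an $R$-linear map with $D(fg)=D(f)g+fD(g)$ for all $f,g$, and $F$ is an $R$-linear map from $I(X,R)$ into its center. If moreover $\le$ is antisymmetric (so that $X$ is a partially ordered set), then this holds with $F(f)=L(f)_d$, the diagonal of $L(f)$, given by $L(f)_d(x,x)=L(f)(x,x)$ and $L(f)_d(x,y)=0$ for $x\neq y$. -/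

import Mathlib

namespace IncidenceAlgebra

/-- A preordered set is connected if any two elements are joined by a finite path in which
consecutive elements are comparable. -/
def IsConnectedPreorder (X : Type*) [Preorder X] : Prop :=
  ∀ x y : X, Relation.ReflTransGen (fun a b : X => a ≤ b ∨ b ≤ a) x y

/-- A ring is `2`-torsion free if `2 r = 0` implies `r = 0`. -/
def IsTwoTorsionFree (R : Type*) [Ring R] : Prop :=
  ∀ r : R, 2 * r = 0 → r = 0

/-- An `R`-linear map `D : A → A` is a derivation of the ring `A` if
`D (f g) = D f g + f D g`. -/
def IsDerivation {R A : Type*} [CommRing R] [Ring A] [Module R A] (D : A →ₗ[R] A) : Prop :=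
  ∀ f g : A, D (f * g) = D f * g + f * D g

/-- An `R`-linear map `L : A → A` is a Lie derivation of the ring `A` if
`L [f, g] = [L f, g] + [f, L g]`, where `[f, g] = f g - g f` is the ring commutator. -/
def IsLieDerivation {R A : Type*} [CommRing R] [Ring A] [Module R A] (L : A →ₗ[R] A) : Prop :=
  ∀ f g : A, L (f * g - g * f) = (L f * g - g * L f) + (f * L g - L g * f)

/-- The diagonal of `f`: it agrees with `f` at the pairs `(x, x)` and vanishes elsewhere. -/
def diagonal {R X : Type*} [Zero R] [Preorder X] [DecidableEq X] (f : IncidenceAlgebra R X) :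
    IncidenceAlgebra R X where
  toFun x y := if x = y then f x y else 0
  eq_zero_of_not_le' _ _ h := if_neg fun e => h e.le

end IncidenceAlgebra

namespace IncidenceAlgebra

/-! ### Matrix units and their products. -/

section MatrixUnits

variable {R X : Type*} [CommRing R] [Preorder X] [DecidableEq X]

/-! Subtracting an inner derivation makes `L` send each diagonal unit `e_x` to a diagonal element.
The corrected map then multiplies each off-diagonal entry by a scalar `weight` (`apply_offDiagonal`)
and has constant diagonal, by connectedness (`apply_diagonal_eq`). The weights are additive along `x
≤ z ≤ y` (`weight_add`), so entrywise scaling by them is a derivation; the leftover constant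
diagonal is central. The inner derivation is put back into `D`. -/

/-- The matrix unit supported at the pair `(x, y)` with `x ≤ y`. -/
def single (R : Type*) [CommRing R] {x y : X} (h : x ≤ y) : IncidenceAlgebra R X where
  toFun a b := if a = x ∧ b = y then 1 else 0
  eq_zero_of_not_le' _ _ hab :=
    if_neg fun (e : _ ∧ _) => hab (by rw [e.1, e.2]; exact h)

theorem single_apply {x y : X} (h : x ≤ y) (a b : X) :
    single R h a b = if a = x ∧ b = y then 1 else 0 := rfl

variable [LocallyFiniteOrder X]

theorem mul_single_apply (f : IncidenceAlgebra R X) {x y : X} (h : x ≤ y) (a b : X) :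
    (f * single R h) a b = if b = y then f a x else 0 := by
  rw [mul_apply]
  by_cases hb : b = y
  · subst hb
    by_cases ha : a ≤ x
    · rw [Finset.sum_eq_single x]
      · simp [single_apply]
      · intro z _ hz
        simp [single_apply, hz]
      · intro hx
        exact absurd (Finset.mem_Icc.2 ⟨ha, h⟩) hx
    · rw [if_pos rfl, apply_eq_zero_of_not_le ha]
      refine Finset.sum_eq_zero fun z _ => ?_
      by_cases hz : z = x
      · rw [hz, apply_eq_zero_of_not_le ha, zero_mul]
      · simp [single_apply, hz]
  · simp [single_apply, hb]

theorem single_mul_apply (f : IncidenceAlgebra R X) {x y : X} (h : x ≤ y) (a b : X) :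
    (single R h * f) a b = if a = x then f y b else 0 := by
  rw [mul_apply]
  by_cases ha : a = x
  · subst ha
    by_cases hb : y ≤ b
    · rw [Finset.sum_eq_single y]
      · simp [single_apply]
      · intro z _ hz
        simp [single_apply, hz]
      · intro hy
        exact absurd (Finset.mem_Icc.2 ⟨h, hb⟩) hy
    · rw [if_pos rfl, apply_eq_zero_of_not_le hb]
      refine Finset.sum_eq_zero fun z _ => ?_
      by_cases hz : z = y
      · rw [hz, apply_eq_zero_of_not_le hb, mul_zero]
      · simp [single_apply, hz]
  · simp [single_apply, ha]

end MatrixUnits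

section Multiplication

variable {R X : Type*} [CommRing R] [Preorder X] [LocallyFiniteOrder X]

theorem smul_mul_eq (r : R) (f g : IncidenceAlgebra R X) : (r • f) * g = r • (f * g) := by
  ext a b _
  simp only [mul_apply, constSMul_apply, smul_eq_mul, Finset.mul_sum, mul_assoc]

theorem mul_smul_eq (r : R) (f g : IncidenceAlgebra R X) : f * (r • g) = r • (f * g) := by
  ext a b _
  simp only [mul_apply, constSMul_apply, smul_eq_mul, Finset.mul_sum]
  exact Finset.sum_congr rfl fun z _ => by ring

theorem diagonal_mul_apply {d : IncidenceAlgebra R X} (hd : ∀ a b, a ≠ b → d a b = 0)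
    (f : IncidenceAlgebra R X) (a b : X) : (d * f) a b = d a a * f a b := by
  by_cases hab : a ≤ b
  · rw [mul_apply, Finset.sum_eq_single a]
    · intro c _ hc
      rw [hd a c hc.symm, zero_mul]
    · intro ha
      exact absurd (Finset.mem_Icc.2 ⟨le_rfl, hab⟩) ha
  · rw [apply_eq_zero_of_not_le hab, apply_eq_zero_of_not_le hab, mul_zero]

theorem mul_diagonal_apply {d : IncidenceAlgebra R X} (hd : ∀ a b, a ≠ b → d a b = 0)
    (f : IncidenceAlgebra R X) (a b : X) : (f * d) a b = f a b * d b b := by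
  by_cases hab : a ≤ b
  · rw [mul_apply, Finset.sum_eq_single b]
    · intro c _ hc
      rw [hd c b hc, mul_zero]
    · intro ha
      exact absurd (Finset.mem_Icc.2 ⟨hab, le_rfl⟩) ha
  · rw [apply_eq_zero_of_not_le hab, apply_eq_zero_of_not_le hab, zero_mul]

end Multiplication

/-! ### Reduction to maps that keep diagonal units diagonal. -/

section LieDerivation

variable {R X : Type*} [CommRing R] [Preorder X] [DecidableEq X] [LocallyFiniteOrder X]

/-- The inner derivation `f ↦ h f - f h`. -/
def inner (h : IncidenceAlgebra R X) : IncidenceAlgebra R X →ₗ[R] IncidenceAlgebra R X where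
  toFun f := h * f - f * h
  map_add' f g := by noncomm_ring
  map_smul' r f := by
    rw [RingHom.id_apply, smul_mul_eq, mul_smul_eq, smul_sub]

theorem inner_apply (h f : IncidenceAlgebra R X) : inner h f = h * f - f * h := rfl

theorem isDerivation_inner (h : IncidenceAlgebra R X) : IsDerivation (inner h) := by
  intro f g
  simp only [inner_apply]
  noncomm_ring

variable {L : IncidenceAlgebra R X →ₗ[R] IncidenceAlgebra R X}

theorem IsLieDerivation.sub_inner (hL : IsLieDerivation L) (h : IncidenceAlgebra R X) :
    IsLieDerivation (L - inner h) := by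
  intro f g
  simp only [LinearMap.sub_apply, hL f g, inner_apply]
  noncomm_ring

theorem IsLieDerivation.apply_eq (hL : IsLieDerivation L) (f g : IncidenceAlgebra R X) (a b : X) :
    L (f * g - g * f) a b =
      ((L f * g) a b - (g * L f) a b) + ((f * L g) a b - (L g * f) a b) := by
  rw [hL f g]
  rfl

/-- The element `h` such that `L - [h, ·]` maps the diagonal matrix units to diagonal elements. -/
def diagonalizer (L : IncidenceAlgebra R X →ₗ[R] IncidenceAlgebra R X) :
    IncidenceAlgebra R X where
  toFun x y := if x = y then 0 else L (single R (le_refl y)) x y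
  eq_zero_of_not_le' x y h := by simp [apply_eq_zero_of_not_le h]

omit [LocallyFiniteOrder X] in
theorem diagonalizer_apply (x y : X) :
    diagonalizer L x y = if x = y then 0 else L (single R (le_refl y)) x y := rfl

/-- A linear map sending every diagonal matrix unit to a diagonal element. -/
def PreservesDiagonalUnits (L : IncidenceAlgebra R X →ₗ[R] IncidenceAlgebra R X) : Prop :=
  ∀ x a b : X, a ≠ b → L (single R (le_refl x)) a b = 0

/-- Since `e_x` and `e_b` commute for `x ≠ b`, `L [e_x, e_b] = 0` forces the off-diagonal entries of
`L e_x` outside column `x` into row `x`, where they are the negatives of the entries `L e_b x b`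
stored in `diagonalizer`. -/
theorem IsLieDerivation.preservesDiagonalUnits_sub_inner (hL : IsLieDerivation L) :
    PreservesDiagonalUnits (L - inner (diagonalizer L)) := by
  intro x a b hab
  have key : ∀ u v : X, u ≠ v → L (single R (le_refl u) * single R (le_refl v) -
      single R (le_refl v) * single R (le_refl u)) = 0 := by
    intro u v huv
    convert L.map_zero using 2
    ext p q _
    simp only [sub_apply, mul_single_apply, single_apply, zero_apply]
    grind
  rw [LinearMap.sub_apply, sub_apply, inner_apply, sub_apply, mul_single_apply, single_mul_apply,
    diagonalizer_apply, diagonalizer_apply]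
  by_cases hb : b = x
  · subst hb
    simp [hab]
  · have h1 := hL.apply_eq (single R (le_refl x)) (single R (le_refl b)) a b
    rw [key x b (Ne.symm hb)] at h1
    simp only [mul_single_apply, single_mul_apply, zero_apply] at h1
    grind

theorem diagonalUnit_commutator (z : X) {x y : X} (h : x ≤ y) :
    single R (le_refl z) * single R h - single R h * single R (le_refl z) =
      ((if z = x then 1 else 0) - (if z = y then 1 else 0) : R) • single R h := by
  ext a b _
  simp only [sub_apply, mul_single_apply, single_apply, constSMul_apply, smul_eq_mul]
  grind

theorem IsLieDerivation.apply_diagonalUnit_eq (hL : IsLieDerivation L) (z : X) {x y : X}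
    (h : x ≤ y) : L (single R (le_refl z)) x x = L (single R (le_refl z)) y y := by
  rcases eq_or_ne x y with rfl | hxy
  · rfl
  have h1 := hL.apply_eq (single R (le_refl z)) (single R h) x y
  rw [diagonalUnit_commutator, map_smul] at h1
  simp only [mul_single_apply, single_mul_apply, constSMul_apply, smul_eq_mul] at h1
  grind

/-! ### Entrywise shape of the corrected map. -/

theorem IsLieDerivation.apply_offDiagonal (hL : IsLieDerivation L) (hR : IsTwoTorsionFree R)
    (hd : PreservesDiagonalUnits L) (f : IncidenceAlgebra R X) {x y : X} (h : x ≤ y)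
    (hxy : x ≠ y) : L f x y = L (single R h) x y * f x y := by
  -- From `[e_u, e_uv] = e_uv`, the `(v, u)` entry equals its own negative.
  have h0 : ∀ {u v : X} (huv : u ≤ v), u ≠ v → L (single R huv) v u = 0 := by
    intro u v huv hne
    by_cases hvu : v ≤ u
    · have h1 := hL.apply_eq (single R (le_refl u)) (single R huv) v u
      rw [diagonalUnit_commutator, map_smul] at h1
      simp only [mul_single_apply, single_mul_apply, constSMul_apply, smul_eq_mul] at h1
      have h2 := hL.apply_diagonalUnit_eq u huv
      apply hR
      grind
    · exact apply_eq_zero_of_not_le hvu _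
  -- The double commutator `[e_x, [f, e_y]]` isolates `f x y • e_xy + f y x • e_yx`; `h0` discards
  -- the second term, present only when `y ≤ x`.
  have hcomm : ∃ g : IncidenceAlgebra R X, L g x y = f x y * L (single R h) x y ∧
      g = single R (le_refl x) * (f * single R (le_refl y) - single R (le_refl y) * f) -
        (f * single R (le_refl y) - single R (le_refl y) * f) * single R (le_refl x) := by
    by_cases hyx : y ≤ x
    · refine ⟨f x y • single R h + f y x • single R hyx, ?_, ?_⟩
      · simp [h0 hyx hxy.symm]
      · ext a b _
        simp only [sub_apply, add_apply, mul_single_apply, single_mul_apply, single_apply,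
          constSMul_apply, smul_eq_mul]
        grind
    · refine ⟨f x y • single R h, ?_, ?_⟩
      · simp [constSMul_apply]
      · have h3 := apply_eq_zero_of_not_le hyx f
        ext a b _
        simp only [sub_apply, mul_single_apply, single_mul_apply, single_apply,
          constSMul_apply, smul_eq_mul]
        grind
  obtain ⟨g, hg, rfl⟩ := hcomm
  rw [hL.apply_eq, hL f] at hg
  simp only [sub_apply, add_apply, mul_single_apply, single_mul_apply, sub_mul, mul_sub] at hg
  have h4 := hL.apply_diagonalUnit_eq x h
  have h5 := hL.apply_diagonalUnit_eq y h
  simp only [diagonal_mul_apply (hd _), mul_diagonal_apply (hd _), mul_single_apply,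
    single_mul_apply] at hg
  grind

theorem IsLieDerivation.apply_single (hL : IsLieDerivation L) (hR : IsTwoTorsionFree R)
    (hd : PreservesDiagonalUnits L) {x y : X} (h : x ≤ y) (hxy : x ≠ y) :
    L (single R h) = L (single R h) x y • single R h := by
  ext a b hle
  rw [constSMul_apply, smul_eq_mul]
  by_cases hab : a = b
  · subst hab
    have h1 := hL.apply_eq (single R (le_refl x)) (single R h) a a
    rw [diagonalUnit_commutator, map_smul] at h1
    simp only [mul_single_apply, single_mul_apply, constSMul_apply, smul_eq_mul] at h1
    have h2 := hd x y x hxy.symm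
    have h3 := hd x x y hxy
    simp only [single_apply]
    grind
  · rw [hL.apply_offDiagonal hR hd _ hle hab, single_apply]
    by_cases hc : a = x ∧ b = y
    · obtain ⟨rfl, rfl⟩ := hc
      rfl
    · simp [hc]

/-- In the `(x, y)` entry of `L [f, e_xy]`, the scalings of `[f, e_xy]` cancel, leaving that of `[L
f, e_xy]`, which is `L f x x - L f y y`. -/
theorem IsLieDerivation.apply_diagonal_eq_of_le (hL : IsLieDerivation L)
    (hR : IsTwoTorsionFree R) (hd : PreservesDiagonalUnits L) (f : IncidenceAlgebra R X) {x y : X}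
    (h : x ≤ y) : L f x x = L f y y := by
  rcases eq_or_ne x y with rfl | hxy
  · rfl
  have h1 := hL.apply_eq f (single R h) x y
  rw [hL.apply_offDiagonal hR hd _ h hxy, hL.apply_single hR hd h hxy, mul_smul_eq,
    smul_mul_eq] at h1
  simp only [sub_apply, mul_single_apply, single_mul_apply, constSMul_apply,
    smul_eq_mul, single_apply] at h1
  grind

theorem IsLieDerivation.apply_diagonal_eq (hL : IsLieDerivation L) (hR : IsTwoTorsionFree R)
    (hX : IsConnectedPreorder X) (hd : PreservesDiagonalUnits L) (f : IncidenceAlgebra R X)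
    (x y : X) : L f x x = L f y y := by
  induction hX x y with
  | refl => rfl
  | tail _ h ih =>
    rw [ih]
    exact h.elim (hL.apply_diagonal_eq_of_le hR hd f)
      fun h' => (hL.apply_diagonal_eq_of_le hR hd f h').symm

/-! ### Additive weights and the derivation they define. -/

open Classical in
/-- The factor by which `L` multiplies the entry at an off-diagonal pair. -/
noncomputable def weight (L : IncidenceAlgebra R X →ₗ[R] IncidenceAlgebra R X) (x y : X) : R :=
  if h : x ≤ y ∧ x ≠ y then L (single R h.1) x y else 0

omit [LocallyFiniteOrder X] in
theorem weight_of_ne {x y : X} (h : x ≤ y) (hxy : x ≠ y) :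
    weight L x y = L (single R h) x y := dif_pos ⟨h, hxy⟩

omit [LocallyFiniteOrder X] in
theorem weight_self (x : X) : weight L x x = 0 := dif_neg fun h => h.2 rfl

/-- `L` scales `[e_xz, e_zy]` by the sum of the weights; for `x ≠ y` compare `(x, y)` entries. -/
theorem IsLieDerivation.weight_add (hL : IsLieDerivation L) (hR : IsTwoTorsionFree R)
    (hd : PreservesDiagonalUnits L) {x y z : X} (hxz : x ≤ z) (hzy : z ≤ y) :
    weight L x y = weight L x z + weight L z y := by
  rcases eq_or_ne x z with rfl | hne
  · rw [weight_self, zero_add]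
  rcases eq_or_ne z y with rfl | hne'
  · rw [weight_self, add_zero]
  have key : L (single R hxz * single R hzy - single R hzy * single R hxz) =
      (weight L x z + weight L z y) •
        (single R hxz * single R hzy - single R hzy * single R hxz) := by
    rw [hL, hL.apply_single hR hd hxz hne, hL.apply_single hR hd hzy hne', weight_of_ne hxz hne,
      weight_of_ne hzy hne']
    simp only [smul_mul_eq, mul_smul_eq]
    module
  rcases eq_or_ne x y with rfl | hxy
  · have h1 := hL.apply_diagonal_eq_of_le hR hd
      (single R hxz * single R hzy - single R hzy * single R hxz) hxz
    rw [key] at h1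
    simp only [sub_apply, mul_single_apply, constSMul_apply, smul_eq_mul, single_apply] at h1
    rw [weight_self]
    refine (hR _ ?_).symm
    grind
  · have h1 := hL.apply_offDiagonal hR hd
      (single R hxz * single R hzy - single R hzy * single R hxz) (hxz.trans hzy) hxy
    rw [key, ← weight_of_ne (hxz.trans hzy) hxy] at h1
    simp only [sub_apply, mul_single_apply, constSMul_apply, smul_eq_mul, single_apply] at h1
    grind

omit [LocallyFiniteOrder X] in
theorem diagonal_apply (f : IncidenceAlgebra R X) (x y : X) :
    diagonal f x y = if x = y then f x y else 0 := rfl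

/-- The linear map taking an element to its diagonal. -/
def diagonalMap : IncidenceAlgebra R X →ₗ[R] IncidenceAlgebra R X where
  toFun := diagonal
  map_add' f g := by
    ext x y _
    simp only [diagonal_apply, add_apply]
    split_ifs <;> simp
  map_smul' r f := by
    ext x y _
    simp [diagonal_apply]

omit [LocallyFiniteOrder X] in
theorem diagonalMap_apply (f : IncidenceAlgebra R X) : diagonalMap f = diagonal f := rfl

theorem diagonal_mem_center {f : IncidenceAlgebra R X} (hf : ∀ x y, f x x = f y y) :
    diagonal f ∈ Subring.center (IncidenceAlgebra R X) := by
  rw [Subring.mem_center_iff]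
  intro g
  have hd : ∀ a b, a ≠ b → diagonal f a b = 0 := fun a b hab => if_neg hab
  ext x y _
  rw [diagonal_mul_apply hd, mul_diagonal_apply hd, diagonal_apply, diagonal_apply, if_pos rfl,
    if_pos rfl, hf x y, mul_comm]

theorem IsLieDerivation.sub_diagonal_apply (hL : IsLieDerivation L) (hR : IsTwoTorsionFree R)
    (hd : PreservesDiagonalUnits L) (f : IncidenceAlgebra R X) (x y : X) :
    (L - diagonalMap ∘ₗ L) f x y = weight L x y * f x y := by
  rw [LinearMap.sub_apply, sub_apply, LinearMap.comp_apply, diagonalMap_apply, diagonal_apply]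
  rcases eq_or_ne x y with rfl | hxy
  · simp [weight_self]
  · by_cases h : x ≤ y
    · rw [if_neg hxy, sub_zero, hL.apply_offDiagonal hR hd f h hxy, weight_of_ne h hxy]
    · simp [apply_eq_zero_of_not_le h]

theorem IsLieDerivation.isDerivation_sub_diagonal (hL : IsLieDerivation L)
    (hR : IsTwoTorsionFree R) (hd : PreservesDiagonalUnits L) :
    IsDerivation (L - diagonalMap ∘ₗ L) := by
  intro f g
  ext x y _
  simp only [add_apply, mul_apply, hL.sub_diagonal_apply hR hd, Finset.mul_sum]
  rw [← Finset.sum_add_distrib]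
  refine Finset.sum_congr rfl fun z hz => ?_
  rw [Finset.mem_Icc] at hz
  rw [hL.weight_add hR hd hz.1 hz.2]
  ring

/-- By antisymmetry `Icc x x = {x}`, so diagonal entries multiply in the commutative ring `R`. Hence
the correction does not alter the diagonal of `L f`. -/
theorem diagonal_inner_of_antisymm (hanti : ∀ x y : X, x ≤ y → y ≤ x → x = y)
    (h f : IncidenceAlgebra R X) : diagonal (inner h f) = 0 := by
  ext x y _
  rw [diagonal_apply, zero_apply]
  rcases eq_or_ne x y with rfl | hxy
  · have hs : Finset.Icc x x = {x} := by
      ext z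
      rw [Finset.mem_Icc, Finset.mem_singleton]
      exact ⟨fun hz => (hanti _ _ hz.1 hz.2).symm, fun hz => hz ▸ ⟨le_rfl, le_rfl⟩⟩
    simp [inner_apply, hs, mul_comm]
  · exact if_neg hxy

end LieDerivation

end IncidenceAlgebra

theorem mainTheorem2 {R : Type*} [CommRing R] {X : Type*} [Preorder X] [LocallyFiniteOrder X]
    [DecidableEq X] (hX : IncidenceAlgebra.IsConnectedPreorder X)
    (hR : IncidenceAlgebra.IsTwoTorsionFree R)
    (L : IncidenceAlgebra R X →ₗ[R] IncidenceAlgebra R X)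
    (hL : IncidenceAlgebra.IsLieDerivation L) :
    ∃ D F : IncidenceAlgebra R X →ₗ[R] IncidenceAlgebra R X,
      IncidenceAlgebra.IsDerivation D ∧
      (∀ f, F f ∈ Subring.center (IncidenceAlgebra R X)) ∧
      L = D + F ∧
      ((∀ x y : X, x ≤ y → y ≤ x → x = y) → ∀ f, F f = IncidenceAlgebra.diagonal (L f)) := by
  open IncidenceAlgebra in
  have hL' := hL.sub_inner (diagonalizer L)
  have hd := hL.preservesDiagonalUnits_sub_inner
  open IncidenceAlgebra in
  refine ⟨(L - inner (diagonalizer L) - diagonalMap ∘ₗ (L - inner (diagonalizer L))) +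
    inner (diagonalizer L), diagonalMap ∘ₗ (L - inner (diagonalizer L)), ?_, ?_, ?_, ?_⟩
  · intro f g
    rw [LinearMap.add_apply, hL'.isDerivation_sub_diagonal hR hd,
      IncidenceAlgebra.isDerivation_inner]
    simp only [LinearMap.add_apply]
    noncomm_ring
  · exact fun f => IncidenceAlgebra.diagonal_mem_center (hL'.apply_diagonal_eq hR hX hd f)
  · abel
  · intro hanti f
    rw [LinearMap.comp_apply, LinearMap.sub_apply, map_sub, IncidenceAlgebra.diagonalMap_apply,
      IncidenceAlgebra.diagonalMap_apply, IncidenceAlgebra.diagonal_inner_of_antisymm hanti,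
      sub_zero]
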